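/- **Setting.** Let $I$ (students) and $N$ (schools/items, one seat each) be finite sets. For each $i\in I$ let $T_i$ be a finite set of strict total rankings of $N$ (for $\tau\in T_i$ write $n\,\tau\,n'$ if $\tau$ ranks $n$ above $n'$), let $T=\prod_i T_i$, and let $\mu$ be a probability measure on $T$ (types may be correlated) with marginals $\mu_i^\bullet$ on $T_i$. Let $\mathcal T^*=\{(i,\tau,n): \mu_i^\bullet(\tau)>0\}$, and call $t\in T$ a state if $\mu_i^\bullet(t_i)>0$ for all $i$. Let $\succ$ be a strict total order on $\mathcal T^*$ (the principal's priority order). *Greedy algorithm.* At a profile $t$, go through the elements of $\mathcal T^*$ in $\succ$-decreasing order and assign $n$ to $i$ upon reaching $(i,\tau,n)$ if $t_i=\tau$ and neither $i$ nor $n$ has been assigned before. The triple $(i,\tau,n)\in\mathcal T^*$ is *blocked* if in no state $t$ with $t_i=\tau$ does the greedy algorithm give $n$ to $i$. The order $\succ$ is - *welfarist* if, for every unblocked $(i,\tau,n)$ and every $n'$, $(i,\tau,n)\succ(i,\tau,n')$ implies $n\,\tau\,n'$; - *item-ranking consistent* if, for all $n$ and $i\ne i'$, whenever $(i,\tau,n)$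 is unblocked and $(i,\tau,n)\succ(i',\tau',n)$ for some $\tau'$, then $(i,\tau'',n)\succ(i',\tau''',n)$ for all $\tau''$ and all $\tau'''$ such that $(i',\tau''',n)$ is unblocked. *Principal's payoff.* An allocation is a map $q:T\times I\times N\to\mathbb R_+$ with $\sum_n q(t,i,n)\le 1$ for all $t,i$ and $\sum_i q(t,i,n)\le 1$ for all $t,n$. Its interim allocation is $Q(i,\tau,n)=\mathbb E_\mu[q(t,i,n)\mid t_i=\tau]$ for $(i,\tau,n)\in\mathcal T^*$; let $\mathcal I\subset\mathbb R^{\mathcal T^*}$ be the set of interim allocations so obtained. Say that $Q$ is dominated by $Q'$ if for every $k\in\mathcal T^*$ $$\sum_{x=(i,\tau,n)\succeq k} Q(x)\,\mu_i^\bullet(\tau)\;\le\;\sum_{x=(i,\tau,n)\succeq k} Q'(x)\,\mu_i^\bullet(\tau).$$ A *payoff function of the principal* is a concave $V:\mathcal I\to\mathbb R$ with $V(0)=0$ and $V(Q)\le V(Q')$ whenever $Q,Q'\in\mathcal I$ and $Q$ is dominated by $Q'$. The *full-information payoff* is $\sup_{Q\in\mathcal I}V(Q)$. *Deferred acceptance.*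 Given priority rankings $(>_n)_{n\in N}$, each $>_n$ a strict total order on $I$, and a profile $t$, run the student-proposing deferred acceptance (DA) algorithm with student preferences $(t_i)_{i\in I}$, where every student and every school is acceptable and being unmatched is worst. Stability is the usual absence of blocking pairs. **Theorem.** Assume that $\succ$ is welfarist and item-ranking consistent. Then there are priority rankings $(>_n)_{n\in N}$ of the students such that 1. in every state $t$ the DA matching equals the matching produced by the greedy algorithm applied to $\succ$, and it is the student-optimal stable matching: it is stable, and every student weakly prefers it to every other stable matching; 2. the interim allocation $Q^{DA}$ induced by DA lies in $\mathcal I$, and for every payoff function $V$ of the principal the full-information payoff is finite and $$V(Q^{DA})\;\ge\;\tfrac12\,\sup_{Q\in\mathcal I}V(Q).$$ -/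

import Mathlib

open Finset

noncomputable section

/-- A strict ranking (strict total order) of the set `α`; `r.above x y` means that `x` is ranked
above `y`. -/
structure StrictRanking (α : Type*) where
  above : α → α → Prop
  isStrictTotalOrder : IsStrictTotalOrder α above

theorem StrictRanking.wellFounded {α : Type*} [Finite α] (r : StrictRanking α) :
    WellFounded r.above := by
  have := r.isStrictTotalOrder
  exact Finite.wellFounded_of_trans_of_irrefl r.above

/-! ### One-to-one matchings, stability and deferred acceptance

Matchings of students `I` to schools `N` are sets of pairs.  Every school is acceptable to every
student and every student to every school; being unmatched is worse than any match. -/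

section Matching

variable {I N : Type*}

def IsMatching (M : Set (I × N)) : Prop :=
  (∀ i m n, (i, m) ∈ M → (i, n) ∈ M → m = n) ∧ (∀ i j n, (i, n) ∈ M → (j, n) ∈ M → i = j)

/-- Student `i` and school `n` would both strictly gain from being matched to each other (a school
or a student without a partner gains from any partner). -/
def BlockingPair (pref : I → StrictRanking N) (prio : N → StrictRanking I) (M : Set (I × N))
    (i : I) (n : N) : Prop :=
  (∀ m, (i, m) ∈ M → (pref i).above n m) ∧ (∀ j, (j, n) ∈ M → (prio n).above i j)

def IsStable (pref : I → StrictRanking N) (prio : N → StrictRanking I) (M : Set (I × N)) : Prop :=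
  IsMatching M ∧ ¬ ∃ i n, BlockingPair pref prio M i n

/-- `M` is stable and every student weakly prefers `M` to every stable matching. -/
def IsStudentOptimalStable (pref : I → StrictRanking N) (prio : N → StrictRanking I)
    (M : Set (I × N)) : Prop :=
  IsStable pref prio M ∧
    ∀ M', IsStable pref prio M' → ∀ i m, (i, m) ∈ M' →
      ∃ n, (i, n) ∈ M ∧ (n = m ∨ (pref i).above n m)

/-- Given the set `X` of pairs (student, school) such that the school has already rejected the
student, student `i` applies to `n`: the best school that has not rejected `i`. -/
def Applies (pref : I → StrictRanking N) (X : Set (I × N)) (i : I) (n : N) : Prop :=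
  (i, n) ∉ X ∧ ∀ m, (i, m) ∉ X → m ≠ n → (pref i).above n m

/-- One round of student-proposing deferred acceptance: every student applies to the best school
that has not rejected them, and each school rejects all applicants except the one with the highest
priority. -/
def daRound (pref : I → StrictRanking N) (prio : N → StrictRanking I) (X : Set (I × N)) :
    Set (I × N) :=
  X ∪ {p | Applies pref X p.1 p.2 ∧ ∃ j, Applies pref X j p.2 ∧ (prio p.2).above j p.1}

/-- The outcome of student-proposing deferred acceptance.  A round without a new rejection leaves
the set of rejections unchanged from then on, and there are at most `|I| * |N|` rejections, so the
algorithm has stopped after `|I| * |N|` rounds; every student is then assigned to the school to which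
they are applying. -/
def deferredAcceptance [Fintype I] [Fintype N] (pref : I → StrictRanking N)
    (prio : N → StrictRanking I) : Set (I × N) :=
  {p | Applies pref ((daRound pref prio)^[Fintype.card I * Fintype.card N] ∅) p.1 p.2}

end Matching

/-! ### Types, states and allocations -/

section Allocation

variable {I N : Type*} [Fintype I] [DecidableEq I] [Fintype N] {T : I → Finset (StrictRanking N)}

/-- Type profiles: the type of agent `i` is an element of the finite set `T i` of strict rankings
of the items. -/
abbrev Profile (T : I → Finset (StrictRanking N)) := (i : I) → T i

open Classical in
/-- The marginal probability that agent `i` has type `τ`. -/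
def marginal (μ : Profile T → ℝ) (i : I) (τ : T i) : ℝ := ∑ t : Profile T with t i = τ, μ t

/-- The types of agent `i` that have positive probability. -/
abbrev PosType (μ : Profile T → ℝ) (i : I) := {τ : T i // 0 < marginal μ i τ}

open Classical in
instance instFintypePosType (μ : Profile T → ℝ) (i : I) : Fintype (PosType μ i) :=
  inferInstanceAs (Fintype {τ : T i // 0 < marginal μ i τ})

/-- The set of triples `⟨i, τ, n⟩` (agent, type of that agent with positive probability, item). -/
abbrev TStar (μ : Profile T → ℝ) := (i : I) × (PosType μ i × N)

/-- States: type profiles in which every agent has a type of positive probability. -/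
def IsState (μ : Profile T → ℝ) (t : Profile T) : Prop := ∀ i, 0 < marginal μ i (t i)

/-- `q t i n` is the probability (or quantity) of item `n` that goes to agent `i` at profile `t`;
agents have unit demand and items have unit supply. -/
def IsAllocation (q : Profile T → I → N → ℝ) : Prop :=
  ∀ t, (∀ i n, 0 ≤ q t i n) ∧ (∀ i, ∑ n, q t i n ≤ 1) ∧ (∀ n, ∑ i, q t i n ≤ 1)

open Classical in
/-- The interim allocation induced by `q`: the expectation of `q t i n` conditional on `t i = τ`. -/
def interim (μ : Profile T → ℝ) (q : Profile T → I → N → ℝ) (x : TStar μ) : ℝ :=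
  (∑ t : Profile T with t x.1 = x.2.1.1, μ t * q t x.1 x.2.2) / marginal μ x.1 x.2.1.1

/-- The realizable interim allocations. -/
def realizable (μ : Profile T → ℝ) : Set (TStar μ → ℝ) :=
  {Q | ∃ q, IsAllocation q ∧ interim μ q = Q}

open Classical in
/-- `Q` is first-order stochastically dominated by `Q'` with respect to the order `R` on triples:
every initial segment of `R` has ex-ante weight under `Q` at most its weight under `Q'`. -/
def FOSDDominated {μ : Profile T → ℝ} (R : StrictRanking (TStar μ)) (Q Q' : TStar μ → ℝ) : Prop :=
  ∀ k : TStar μ,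
    ∑ x : TStar μ with x = k ∨ R.above x k, Q x * marginal μ x.1 x.2.1.1 ≤
      ∑ x : TStar μ with x = k ∨ R.above x k, Q' x * marginal μ x.1 x.2.1.1

/-- `V` is a payoff function, on realizable interim allocations, of a principal with priority order
`R`: concave, zero at the null allocation, and monotone with respect to `R`-FOSD shifts. -/
structure IsPrincipalPayoff {μ : Profile T → ℝ} (R : StrictRanking (TStar μ))
    (V : (TStar μ → ℝ) → ℝ) : Prop where
  concave : ConcaveOn ℝ (realizable μ) V
  null : V 0 = 0
  monotone : ∀ Q ∈ realizable μ, ∀ Q' ∈ realizable μ, FOSDDominated R Q Q' → V Q ≤ V Q'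

/-- The best payoff over all realizable interim allocations (the principal knows the types, so that
there are no incentive constraints). -/
def fullInformationPayoff (μ : Profile T → ℝ) (V : (TStar μ → ℝ) → ℝ) : ℝ :=
  sSup (V '' realizable μ)

/-! ### The greedy algorithm -/

/-- The triples selected by the greedy algorithm at the profile `t`: going through the triples in
`R`-decreasing order, `⟨i, τ, n⟩` is selected if `t i = τ` and no triple selected before has the same
agent or the same item. -/
def greedySelects {μ : Profile T → ℝ} (R : StrictRanking (TStar μ)) (t : Profile T) :
    TStar μ → Prop :=
  R.wellFounded.fix fun x selected =>
    t x.1 = x.2.1.1 ∧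
      ∀ (y : TStar μ) (h : R.above y x), selected y h → x.1 ≠ y.1 ∧ x.2.2 ≠ y.2.2

theorem greedySelects_iff {μ : Profile T → ℝ} (R : StrictRanking (TStar μ)) (t : Profile T)
    (x : TStar μ) :
    greedySelects R t x ↔ t x.1 = x.2.1.1 ∧
      ∀ y : TStar μ, R.above y x → greedySelects R t y → x.1 ≠ y.1 ∧ x.2.2 ≠ y.2.2 := by
  conv_lhs => rw [greedySelects, WellFounded.fix_eq]
  rfl

/-- The pairs (agent, item) assigned by the greedy algorithm at the profile `t`. -/
def greedy {μ : Profile T → ℝ} (R : StrictRanking (TStar μ)) (t : Profile T) : Set (I × N) :=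
  {p | ∃ x : TStar μ, greedySelects R t x ∧ (x.1, x.2.2) = p}

/-- In no state in which `i` has type `τ` does the greedy algorithm give `n` to `i`. -/
def Blocked {μ : Profile T → ℝ} (R : StrictRanking (TStar μ)) (i : I) (τ : PosType μ i) (n : N) :
    Prop :=
  ¬ ∃ t : Profile T, IsState μ t ∧ t i = τ.1 ∧ (i, n) ∈ greedy R t

def IsItemRankingConsistent {μ : Profile T → ℝ} (R : StrictRanking (TStar μ)) : Prop :=
  ∀ (n : N) (i i' : I), i ≠ i' → ∀ (τ : PosType μ i) (τ' : PosType μ i'),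
    ¬ Blocked R i τ n → R.above ⟨i, τ, n⟩ ⟨i', τ', n⟩ →
      ∀ (τ'' : PosType μ i) (τ''' : PosType μ i'),
        ¬ Blocked R i' τ''' n → R.above ⟨i, τ'', n⟩ ⟨i', τ''', n⟩

def IsWelfarist {μ : Profile T → ℝ} (R : StrictRanking (TStar μ)) : Prop :=
  ∀ (i : I) (τ : PosType μ i) (n n' : N),
    ¬ Blocked R i τ n → R.above ⟨i, τ, n⟩ ⟨i, τ, n'⟩ → τ.1.1.above n n'

/-! ### Deferred acceptance as an allocation -/

/-- The matching produced by deferred acceptance when the students' preferences are the rankings in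
the profile `t`. -/
def daMatching (prio : N → StrictRanking I) (t : Profile T) : Set (I × N) :=
  deferredAcceptance (fun i => (t i).1) prio

open Classical in
def daAllocation (prio : N → StrictRanking I) (t : Profile T) (i : I) (n : N) : ℝ :=
  if (i, n) ∈ daMatching prio t then 1 else 0

end Allocation

end

/-! Each unassigned pair is preceded in `R` by an assigned pair with the same agent or the same item
(`exists_greedy_above`). Both claims rest on this.

Stability: item-ranking consistency makes the comparison of agents at an item through their
unblocked triples a strict partial order; any linear extension serves as the priority ranking.
Assigned triples are unblocked, so an agent denied an item gets a better one (welfarism) or loses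
the item to an agent of higher priority (`greedy_cases`). Induction along `R` makes the greedy
matching student-optimal (`isStudentOptimalStable_greedy`). So is the DA matching, and there is only
one such matching.

Payoff: within an initial segment of `R`, charge each pair to an assigned pair in the segment
sharing its row or column. A row and a column carry total weight at most 2, so half of any interim
allocation is dominated by that of DA (`fosdDominated_half`). Concavity and `V 0 = 0` turn this into
the factor 1/2. -/

noncomputable section

/-! ### Strict rankings -/

namespace StrictRanking

variable {α : Type*} (r : StrictRanking α)

theorem irrefl (x : α) : ¬ r.above x x :=
  have := r.isStrictTotalOrder
  irrefl_of r.above x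

theorem trans {x y z : α} (h : r.above x y) (h' : r.above y z) : r.above x z :=
  have := r.isStrictTotalOrder
  trans_of r.above h h'

theorem asymm {x y : α} (h : r.above x y) : ¬ r.above y x :=
  fun h' => r.irrefl x (r.trans h h')

theorem above_or_above {x y : α} (h : x ≠ y) : r.above x y ∨ r.above y x := by
  have := r.isStrictTotalOrder
  rcases trichotomous_of r.above x y with h' | h' | h'
  exacts [Or.inl h', absurd h' h, Or.inr h']

theorem exists_top [Finite α] {s : Set α} (hs : s.Nonempty) :
    ∃ x ∈ s, ∀ y ∈ s, y ≠ x → r.above x y := by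
  obtain ⟨x, hx, h⟩ := r.wellFounded.has_min s hs
  exact ⟨x, hx, fun y hy hne => (r.above_or_above hne.symm).resolve_right (h y hy)⟩

/-- Every transitive irreflexive relation extends to a strict ranking. -/
theorem exists_extension (p : α → α → Prop) (hirr : ∀ x, ¬ p x x)
    (htrans : ∀ x y z, p x y → p y z → p x z) :
    ∃ r : StrictRanking α, ∀ x y, p x y → r.above x y := by
  -- Szpilrajn's theorem concerns reflexive orders: pass to the reflexive closure, extend, and take
  -- the strict part.
  have hpo : IsPartialOrder α fun x y => x = y ∨ p x y :=
    { refl := fun x => Or.inl rfl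
      trans := by
        rintro x y z (rfl | h) (rfl | h')
        exacts [Or.inl rfl, Or.inr h', Or.inr h, Or.inr (htrans _ _ _ h h')]
      antisymm := by
        rintro x y (rfl | h) (h' | h')
        exacts [rfl, rfl, h'.symm, absurd (htrans _ _ _ h h') (hirr x)] }
  obtain ⟨s, hs, hps⟩ := extend_partialOrder fun x y => x = y ∨ p x y
  refine ⟨⟨fun x y => s x y ∧ x ≠ y, ?_⟩, fun x y h => ⟨hps x y (Or.inr h), ?_⟩⟩
  · exact
      { trichotomous := fun x y h h' => by
          by_contra hne
          rcases hs.total x y with h1 | h1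
          exacts [h ⟨h1, hne⟩, h' ⟨h1, Ne.symm hne⟩]
        irrefl := fun x h => h.2 rfl
        trans := fun x y z h h' => ⟨hs.trans _ _ _ h.1 h'.1, by
          rintro rfl
          exact h.2 (hs.antisymm _ _ h.1 h'.1)⟩ }
  · rintro rfl
    exact hirr x h

end StrictRanking

/-! ### Deferred acceptance -/

/-- Every step that is not stationary adds an element, so after `Fintype.card α` steps the iterate
is stationary or already the whole type. -/
theorem isFixedPt_iterate_card_of_inflationary {α : Type*} [Fintype α] (f : Set α → Set α)
    (hf : ∀ X, X ⊆ f X) : f (f^[Fintype.card α] ∅) = f^[Fintype.card α] ∅ := by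
  have key : ∀ k, f (f^[k] ∅) = f^[k] ∅ ∨ k ≤ (f^[k] ∅).ncard := by
    intro k
    induction k with
    | zero => exact Or.inr (Nat.zero_le _)
    | succ k ih =>
      rw [Function.iterate_succ_apply']
      by_cases h : f (f^[k] ∅) = f^[k] ∅
      · exact Or.inl (congrArg f h)
      · refine Or.inr ((ih.resolve_left h).trans_lt (Set.ncard_lt_ncard ?_ (Set.toFinite _)))
        exact (hf _).ssubset_of_ne (Ne.symm h)
  rcases key (Fintype.card α) with h | h
  · exact h
  · have huniv : f^[Fintype.card α] ∅ = Set.univ :=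
      Set.eq_of_subset_of_ncard_le (Set.subset_univ _) (by simpa [Set.ncard_univ] using h)
    refine Set.Subset.antisymm ?_ (hf _)
    rw [huniv]
    exact Set.subset_univ _

section Matching

variable {I N : Type*} {pref : I → StrictRanking N} {prio : N → StrictRanking I}

theorem Applies.unique {X : Set (I × N)} {i : I} {m n : N} (hm : Applies pref X i m)
    (hn : Applies pref X i n) : m = n := by
  by_contra h
  exact (pref i).asymm (hm.2 n hn.1 (Ne.symm h)) (hn.2 m hm.1 h)

theorem exists_applies [Finite N] {X : Set (I × N)} {i : I} {n : N} (h : (i, n) ∉ X) :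
    ∃ m, Applies pref X i m ∧ (m = n ∨ (pref i).above m n) := by
  obtain ⟨m, hm, htop⟩ := (pref i).exists_top (s := {m | (i, m) ∉ X}) ⟨n, h⟩
  refine ⟨m, ⟨hm, htop⟩, ?_⟩
  by_cases hmn : m = n
  exacts [Or.inl hmn, Or.inr (htop n h (Ne.symm hmn))]

/-- A school that has rejected a student has an applicant of higher priority. -/
def RejectionsJustified (pref : I → StrictRanking N) (prio : N → StrictRanking I)
    (X : Set (I × N)) : Prop :=
  ∀ i n, (i, n) ∈ X → ∃ j, Applies pref X j n ∧ (prio n).above j i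

/-- The applicant of highest priority survives the round, keeps applying, and outranks everyone
rejected before or now. -/
theorem RejectionsJustified.daRound [Finite I] {X : Set (I × N)}
    (hX : RejectionsJustified pref prio X) :
    RejectionsJustified pref prio (daRound pref prio X) := by
  intro i n hin
  have hj : ∃ j, Applies pref X j n ∧ (prio n).above j i := hin.elim (hX i n) fun h => h.2
  obtain ⟨j, hj, hji⟩ := hj
  obtain ⟨k, hk, htop⟩ := (prio n).exists_top (s := {k | Applies pref X k n}) ⟨j, hj⟩
  refine ⟨k, ⟨?_, fun m hm => hk.2 m fun h => hm (Or.inl h)⟩, ?_⟩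
  · rintro (h | ⟨-, l, hl, hlk⟩)
    · exact hk.1 h
    · have hne : l ≠ k := by
        rintro rfl
        exact (prio n).irrefl _ hlk
      exact (prio n).asymm hlk (htop l hl hne)
  · by_cases hjk : j = k
    · exact hjk ▸ hji
    · exact (prio n).trans (htop j hj hjk) hji

/-- DA never rejects a stable pair: if `n` turned away its `M`-partner for `j`, then `j`, whose
`M`-partner has not rejected `j`, would prefer `n` to it and block `M` with `n`. -/
theorem IsStable.disjoint_daRound {X M : Set (I × N)} (hM : IsStable pref prio M)
    (hX : ∀ p ∈ M, p ∉ X) : ∀ p ∈ M, p ∉ daRound pref prio X := by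
  rintro ⟨i, n⟩ hp (h | ⟨-, j, hj, hji⟩)
  · exact hX _ hp h
  · refine hM.2 ⟨j, n, fun m hm => hj.2 m (hX _ hm) ?_, fun k hk => ?_⟩
    · rintro rfl
      rw [hM.1.2 _ _ _ hp hm] at hji
      exact (prio m).irrefl _ hji
    · rw [hM.1.2 _ _ _ hk hp]
      exact hji

theorem isStable_of_daRound_eq [Finite N] {X : Set (I × N)} (hfix : daRound pref prio X = X)
    (hX : RejectionsJustified pref prio X) :
    IsStable pref prio {p | Applies pref X p.1 p.2} := by
  have hno : ∀ i j n, Applies pref X i n → Applies pref X j n → ¬ (prio n).above j i :=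
    fun i j n hi hj h => hi.1 (hfix ▸ Or.inr ⟨hi, j, hj, h⟩)
  refine ⟨⟨fun i m n hm hn => Applies.unique hm hn, fun i j n hi hj => ?_⟩, ?_⟩
  · by_contra hne
    rcases (prio n).above_or_above hne with h | h
    exacts [hno j i n hj hi h, hno i j n hi hj h]
  · rintro ⟨i, n, hpref, hprio⟩
    by_cases hin : (i, n) ∈ X
    · obtain ⟨j, hj, hji⟩ := hX i n hin
      exact (prio n).asymm hji (hprio j hj)
    · obtain ⟨m, hm, hmn⟩ := exists_applies (pref := pref) hin
      have hnm := hpref m hm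
      rcases hmn with rfl | hmn
      exacts [(pref i).irrefl _ hnm, (pref i).asymm hnm hmn]

theorem isStudentOptimalStable_deferredAcceptance [Fintype I] [Fintype N]
    (pref : I → StrictRanking N) (prio : N → StrictRanking I) :
    IsStudentOptimalStable pref prio (deferredAcceptance pref prio) := by
  have hfix := isFixedPt_iterate_card_of_inflationary (daRound pref prio)
    fun X => Set.subset_union_left
  rw [Fintype.card_prod] at hfix
  have hjust : ∀ k, RejectionsJustified pref prio ((daRound pref prio)^[k] ∅) := by
    intro k
    induction k with
    | zero => exact fun i n h => h.elim
    | succ k ih =>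
      rw [Function.iterate_succ_apply']
      exact ih.daRound
  refine ⟨isStable_of_daRound_eq hfix (hjust _), fun M hM i m him => ?_⟩
  have hdisj : ∀ k, ∀ p ∈ M, p ∉ (daRound pref prio)^[k] ∅ := by
    intro k
    induction k with
    | zero => exact fun p _ h => h.elim
    | succ k ih =>
      rw [Function.iterate_succ_apply']
      exact hM.disjoint_daRound ih
  exact exists_applies (hdisj _ _ him)

theorem IsStudentOptimalStable.subset {M M' : Set (I × N)}
    (hM : IsStudentOptimalStable pref prio M) (hM' : IsStudentOptimalStable pref prio M') :
    M ⊆ M' := by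
  rintro ⟨i, m⟩ hm
  obtain ⟨n, hn, hnm⟩ := hM'.2 M hM.1 i m hm
  obtain ⟨k, hk, hkn⟩ := hM.2 M' hM'.1 i n hn
  obtain rfl : k = m := hM.1.1.1 _ _ _ hk hm
  rcases hnm with rfl | hnm
  · exact hn
  · rcases hkn with rfl | hkn
    exacts [hn, absurd hnm ((pref i).asymm hkn)]

theorem IsStudentOptimalStable.eq {M M' : Set (I × N)}
    (hM : IsStudentOptimalStable pref prio M) (hM' : IsStudentOptimalStable pref prio M') :
    M = M' :=
  (hM.subset hM').antisymm (hM'.subset hM)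

end Matching

section Allocation

variable {I N : Type*} [Fintype I] [DecidableEq I] [Fintype N] {T : I → Finset (StrictRanking N)}
  {μ : Profile T → ℝ} {R : StrictRanking (TStar μ)}

/-! ### The greedy matching -/

/-- The triple formed by an agent, the type of the agent in the state `t`, and an item. -/
def stateTriple {t : Profile T} (ht : IsState μ t) (i : I) (n : N) : TStar μ := ⟨i, ⟨t i, ht i⟩, n⟩

omit [Fintype N] in
theorem eq_stateTriple {t : Profile T} (ht : IsState μ t) {x : TStar μ} (hx : t x.1 = x.2.1.1) :
    x = stateTriple ht x.1 x.2.2 := by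
  obtain ⟨i, ⟨τ, hτ⟩, n⟩ := x
  obtain rfl : t i = τ := hx
  rfl

theorem mem_greedy_iff {t : Profile T} (ht : IsState μ t) {i : I} {n : N} :
    (i, n) ∈ greedy R t ↔ greedySelects R t (stateTriple ht i n) := by
  constructor
  · rintro ⟨x, hx, hxp⟩
    have hx' := eq_stateTriple ht ((greedySelects_iff R t x).1 hx).1
    obtain ⟨rfl, rfl⟩ := Prod.mk.inj hxp
    rwa [← hx']
  · exact fun h => ⟨_, h, rfl⟩

theorem not_blocked_of_mem_greedy {t : Profile T} (ht : IsState μ t) {i : I} {n : N}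
    (h : (i, n) ∈ greedy R t) : ¬ Blocked R i ⟨t i, ht i⟩ n :=
  not_not.2 ⟨t, ht, rfl, h⟩

theorem isMatching_greedy {t : Profile T} (ht : IsState μ t) : IsMatching (greedy R t) := by
  have key : ∀ i j m n, (i, m) ∈ greedy R t → (j, n) ∈ greedy R t →
      R.above (stateTriple ht i m) (stateTriple ht j n) → j ≠ i ∧ n ≠ m :=
    fun i j m n hm hn h => ((greedySelects_iff R t _).1 ((mem_greedy_iff ht).1 hn)).2 _ h
      ((mem_greedy_iff ht).1 hm)
  constructor
  · intro i m n hm hn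
    by_contra hne
    have hne' : stateTriple ht i m ≠ stateTriple ht i n := fun h =>
      hne (congrArg (fun x : TStar μ => x.2.2) h)
    rcases R.above_or_above hne' with h | h
    exacts [(key _ _ _ _ hm hn h).1 rfl, (key _ _ _ _ hn hm h).1 rfl]
  · intro i j n hi hj
    by_contra hne
    have hne' : stateTriple ht i n ≠ stateTriple ht j n := fun h =>
      hne (congrArg (fun x : TStar μ => x.1) h)
    rcases R.above_or_above hne' with h | h
    exacts [(key _ _ _ _ hi hj h).2 rfl, (key _ _ _ _ hj hi h).2 rfl]

/-- A pair that is not assigned by the greedy algorithm is preceded by an assigned pair with the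
same agent or the same item. -/
theorem exists_greedy_above {t : Profile T} (ht : IsState μ t) {i : I} {n : N}
    (h : (i, n) ∉ greedy R t) :
    (∃ m, (i, m) ∈ greedy R t ∧ R.above (stateTriple ht i m) (stateTriple ht i n)) ∨
      ∃ j, (j, n) ∈ greedy R t ∧ R.above (stateTriple ht j n) (stateTriple ht i n) := by
  rw [mem_greedy_iff ht, greedySelects_iff] at h
  push Not at h
  obtain ⟨y, hy, hsel, hor⟩ := h rfl
  have hy' := eq_stateTriple ht ((greedySelects_iff R t y).1 hsel).1
  have hmem : (y.1, y.2.2) ∈ greedy R t := ⟨y, hsel, rfl⟩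
  rw [hy'] at hy
  by_cases hi : i = y.1
  · subst hi
    exact Or.inl ⟨y.2.2, hmem, hy⟩
  · obtain rfl : n = y.2.2 := hor hi
    exact Or.inr ⟨y.1, hmem, hy⟩

/-- The priority rankings respect the order `R` on triples: agents who precede another agent at an
item with an unblocked triple have a higher priority. -/
def PrioritiesRespect (R : StrictRanking (TStar μ)) (prio : N → StrictRanking I) : Prop :=
  ∀ (n : N) (i j : I) (τ : PosType μ i) (τ' : PosType μ j), i ≠ j → ¬ Blocked R i τ n →
    R.above ⟨i, τ, n⟩ ⟨j, τ', n⟩ → (prio n).above i j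

theorem exists_prioritiesRespect (hC : IsItemRankingConsistent R) :
    ∃ prio : N → StrictRanking I, PrioritiesRespect R prio := by
  have key : ∀ n : N, ∃ r : StrictRanking I, ∀ i j : I,
      (i ≠ j ∧ (∃ τ, ¬ Blocked R i τ n) ∧
        ∀ τ τ', ¬ Blocked R j τ' n → R.above ⟨i, τ, n⟩ ⟨j, τ', n⟩) → r.above i j := by
    intro n
    refine StrictRanking.exists_extension _ (fun i h => h.1 rfl) ?_
    rintro i j k ⟨-, ⟨τ, hτ⟩, hij⟩ ⟨-, ⟨σ, hσ⟩, hjk⟩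
    -- The unblocked triple `σ` of the middle agent links the two comparisons; hence the relation
    -- demands that one exists.
    refine ⟨?_, ⟨τ, hτ⟩, fun τ' κ hκ => R.trans (hij τ' σ hσ) (hjk σ κ hκ)⟩
    rintro rfl
    exact R.asymm (hij τ σ hσ) (hjk σ τ hτ)
  choose prio hprio using key
  exact ⟨prio, fun n i j τ τ' hne hτ h =>
    hprio n i j ⟨hne, ⟨τ, hτ⟩, hC n i j hne τ τ' hτ h⟩⟩

/-! ### Stability and student-optimality of the greedy matching -/

section Stability

variable {prio : N → StrictRanking I} {t : Profile T}

/-- An agent is denied an item only if the item goes, earlier, to an agent of higher priority, or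
the agent gets a better item. -/
theorem greedy_cases (hW : IsWelfarist R) (hp : PrioritiesRespect R prio) (ht : IsState μ t)
    {i : I} {n : N} (h : (i, n) ∉ greedy R t) :
    (∃ m, (i, m) ∈ greedy R t ∧ (t i).1.above m n) ∨
      ∃ j, (j, n) ∈ greedy R t ∧ (prio n).above j i ∧
        R.above (stateTriple ht j n) (stateTriple ht i n) := by
  rcases exists_greedy_above ht h with ⟨m, hm, hab⟩ | ⟨j, hj, hab⟩
  · exact Or.inl ⟨m, hm, hW i _ m n (not_blocked_of_mem_greedy ht hm) hab⟩
  · refine Or.inr ⟨j, hj, hp n j i _ _ ?_ (not_blocked_of_mem_greedy ht hj) hab, hab⟩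
    rintro rfl
    exact h hj

theorem isStable_greedy (hW : IsWelfarist R) (hp : PrioritiesRespect R prio) (ht : IsState μ t) :
    IsStable (fun i => (t i).1) prio (greedy R t) := by
  refine ⟨isMatching_greedy ht, ?_⟩
  rintro ⟨i, n, hpref, hprio⟩
  by_cases hin : (i, n) ∈ greedy R t
  · exact (prio n).irrefl i (hprio i hin)
  · rcases greedy_cases hW hp ht hin with ⟨m, hm, hab⟩ | ⟨j, hj, hab, -⟩
    exacts [(t i).1.asymm (hpref m hm) hab, (prio n).asymm (hprio j hj) hab]

/-- If `j` takes `m` from `i`, stability of `M` forces `j` to have in `M` some `n` better than `m`.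
That pair comes earlier in `R`, so by induction greedy serves `j` at least as well as `n`, yet it
gives `m`. -/
theorem isStudentOptimalStable_greedy (hW : IsWelfarist R) (hp : PrioritiesRespect R prio)
    (ht : IsState μ t) : IsStudentOptimalStable (fun i => (t i).1) prio (greedy R t) := by
  refine ⟨isStable_greedy hW hp ht, fun M hM => ?_⟩
  suffices h : ∀ x : TStar μ, ∀ i m, stateTriple ht i m = x → (i, m) ∈ M →
      ∃ n, (i, n) ∈ greedy R t ∧ (n = m ∨ (t i).1.above n m) from fun i m => h _ i m rfl
  intro x
  induction x using R.wellFounded.induction with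
  | _ x ih =>
  rintro i m rfl him
  by_cases hg : (i, m) ∈ greedy R t
  · exact ⟨m, hg, Or.inl rfl⟩
  rcases greedy_cases hW hp ht hg with ⟨n, hn, hab⟩ | ⟨j, hj, hji, hab⟩
  · exact ⟨n, hn, Or.inr hab⟩
  exfalso
  have hnb : ¬ BlockingPair (fun i => (t i).1) prio M j m := fun h => hM.2 ⟨j, m, h⟩
  have hprio : ∀ k, (k, m) ∈ M → (prio m).above j k := by
    intro k hk
    rw [hM.1.2 _ _ _ hk him]
    exact hji
  have hn : ∃ n, (j, n) ∈ M ∧ ¬ (t j).1.above m n := by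
    by_contra hcon
    push Not at hcon
    exact hnb ⟨hcon, hprio⟩
  obtain ⟨n, hjn, hmn⟩ := hn
  have hne : n ≠ m := by
    rintro rfl
    exact (prio n).irrefl j (hprio j hjn)
  have hab' : R.above (stateTriple ht j n) (stateTriple ht j m) := by
    have hne' : stateTriple ht j n ≠ stateTriple ht j m := fun h =>
      hne (congrArg (fun x : TStar μ => x.2.2) h)
    -- Greedy gives `m` to `j`, so that triple is unblocked and welfarism applies to it.
    exact (R.above_or_above hne').resolve_right fun h =>
      hmn (hW j _ m n (not_blocked_of_mem_greedy ht hj) h)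
  obtain ⟨k, hk, hkn⟩ := ih _ (R.trans hab' hab) j n rfl hjn
  obtain rfl : k = m := (isMatching_greedy ht).1 _ _ _ hk hj
  rcases hkn with h | h
  exacts [hne h.symm, hmn h]

theorem daMatching_eq_greedy (hW : IsWelfarist R) (hp : PrioritiesRespect R prio)
    (ht : IsState μ t) : daMatching prio t = greedy R t :=
  (isStudentOptimalStable_deferredAcceptance _ _).eq (isStudentOptimalStable_greedy hW hp ht)

end Stability

/-! ### Payoffs -/

open Classical in
/-- A fractional matching has at most twice as much weight on a set of pairs as there are elements
in a set of pairs that meets each of them in a row or a column. -/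
theorem sum_le_two_mul_card {a : I → N → ℝ} (h0 : ∀ i n, 0 ≤ a i n) (hrow : ∀ i, ∑ n, a i n ≤ 1)
    (hcol : ∀ n, ∑ i, a i n ≤ 1) {B S : Finset (I × N)}
    (hBS : ∀ p ∈ B, ∃ s ∈ S, p.1 = s.1 ∨ p.2 = s.2) :
    ∑ p ∈ B, a p.1 p.2 ≤ 2 * (#S : ℝ) := by
  -- The charge of `p` to `s`; the pair `p = s` is counted twice, which only weakens the bound.
  let c (p s : I × N) : ℝ :=
    (if p.1 = s.1 then a p.1 p.2 else 0) + if p.2 = s.2 then a p.1 p.2 else 0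
  have hc0 : ∀ p s, 0 ≤ c p s := fun p s =>
    add_nonneg (by split_ifs <;> simp [h0]) (by split_ifs <;> simp [h0])
  have hc1 : ∀ p s, p.1 = s.1 ∨ p.2 = s.2 → a p.1 p.2 ≤ c p s := by
    intro p s h
    have := h0 p.1 p.2
    simp only [c]
    split_ifs <;> first | linarith | tauto
  have hc2 : ∀ s, ∑ p, c p s ≤ 2 := by
    intro s
    have h1 : ∑ p : I × N, (if p.1 = s.1 then a p.1 p.2 else 0) = ∑ n, a s.1 n := by
      rw [Fintype.sum_prod_type_right]
      simp
    have h2 : ∑ p : I × N, (if p.2 = s.2 then a p.1 p.2 else 0) = ∑ i, a i s.2 := by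
      rw [Fintype.sum_prod_type]
      simp
    rw [Finset.sum_add_distrib, h1, h2]
    linarith [hrow s.1, hcol s.2]
  calc ∑ p ∈ B, a p.1 p.2
      ≤ ∑ p ∈ B, ∑ s ∈ S, c p s := by
        refine Finset.sum_le_sum fun p hp => ?_
        obtain ⟨s, hs, h⟩ := hBS p hp
        exact (hc1 p s h).trans (Finset.single_le_sum (fun s _ => hc0 p s) hs)
    _ = ∑ s ∈ S, ∑ p ∈ B, c p s := Finset.sum_comm
    _ ≤ ∑ s ∈ S, (2 : ℝ) := Finset.sum_le_sum fun s _ =>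
        (Finset.sum_le_univ_sum_of_nonneg fun p => hc0 p s).trans (hc2 s)
    _ = 2 * (#S : ℝ) := by rw [Finset.sum_const, nsmul_eq_mul, mul_comm]

-- Weighting by the marginal cancels the conditioning, which reduces dominance to a comparison
-- profile by profile.
omit [Fintype N] in
open Classical in
theorem sum_interim_mul_marginal (A : Finset (TStar μ)) (q : Profile T → I → N → ℝ) :
    ∑ x ∈ A, interim μ q x * marginal μ x.1 x.2.1.1 =
      ∑ t, μ t * ∑ x ∈ A with t x.1 = x.2.1.1, q t x.1 x.2.2 := by
  have h : ∀ x ∈ A, interim μ q x * marginal μ x.1 x.2.1.1 =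
      ∑ t : Profile T, if t x.1 = x.2.1.1 then μ t * q t x.1 x.2.2 else 0 := by
    intro x _
    rw [interim, div_mul_cancel₀ _ x.2.1.2.ne', Finset.sum_filter]
  rw [Finset.sum_congr rfl h, Finset.sum_comm]
  refine Finset.sum_congr rfl fun t _ => ?_
  rw [Finset.sum_filter, Finset.mul_sum]
  exact Finset.sum_congr rfl fun x _ => by split_ifs <;> simp

omit [Fintype N] in
theorem isState_of_pos (hμ : ∀ t, 0 ≤ μ t) {t : Profile T} (ht : 0 < μ t) : IsState μ t := by
  classical
  intro i
  exact ht.trans_le (Finset.single_le_sum (f := μ) (fun t _ => hμ t) (by simp))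

open Classical in
/-- In a state, the initial segment of an allocation has at most twice the weight of the initial
segment of the greedy matching. -/
theorem sum_segment_le {t : Profile T} (ht : IsState μ t) {a : I → N → ℝ}
    (h0 : ∀ i n, 0 ≤ a i n) (hrow : ∀ i, ∑ n, a i n ≤ 1) (hcol : ∀ n, ∑ i, a i n ≤ 1)
    {A : Finset (TStar μ)} (hA : ∀ x ∈ A, ∀ y, R.above y x → y ∈ A) :
    ∑ x ∈ A with t x.1 = x.2.1.1, a x.1 x.2.2 ≤
      2 * ∑ x ∈ A with t x.1 = x.2.1.1, if (x.1, x.2.2) ∈ greedy R t then (1 : ℝ) else 0 := by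
  let B : Finset (I × N) := {p | stateTriple ht p.1 p.2 ∈ A}
  have hsum : ∀ f : I → N → ℝ,
      ∑ x ∈ A with t x.1 = x.2.1.1, f x.1 x.2.2 = ∑ p ∈ B, f p.1 p.2 := by
    intro f
    refine Finset.sum_bij' (fun x _ => (x.1, x.2.2)) (fun p _ => stateTriple ht p.1 p.2)
      ?_ ?_ ?_ ?_ ?_
    · intro x hx
      rw [Finset.mem_filter] at hx
      simp only [B, Finset.mem_filter, Finset.mem_univ, true_and]
      rw [← eq_stateTriple ht hx.2]
      exact hx.1
    · intro p hp
      simp only [B, Finset.mem_filter, Finset.mem_univ, true_and] at hp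
      exact Finset.mem_filter.2 ⟨hp, rfl⟩
    · intro x hx
      exact (eq_stateTriple ht (Finset.mem_filter.1 hx).2).symm
    · exact fun p _ => rfl
    · exact fun x _ => rfl
  rw [hsum a, hsum fun i n => if (i, n) ∈ greedy R t then (1 : ℝ) else 0]
  have hcard : ∑ p ∈ B, (if (p.1, p.2) ∈ greedy R t then (1 : ℝ) else 0) =
      #{p ∈ B | p ∈ greedy R t} := by simp
  rw [hcard]
  refine sum_le_two_mul_card h0 hrow hcol ?_
  rintro ⟨i, n⟩ hp
  have hin : stateTriple ht i n ∈ A := by simpa [B] using hp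
  by_cases hg : (i, n) ∈ greedy R t
  · exact ⟨(i, n), Finset.mem_filter.2 ⟨hp, hg⟩, Or.inl rfl⟩
  -- The conflicting assigned pair comes earlier, hence lies in the same initial segment.
  rcases exists_greedy_above ht hg with ⟨m, hm, hab⟩ | ⟨j, hj, hab⟩
  · exact ⟨(i, m), by simp [B, hm, hA _ hin _ hab], Or.inl rfl⟩
  · exact ⟨(j, n), by simp [B, hj, hA _ hin _ hab], Or.inr rfl⟩

theorem fosdDominated_half (hμ : ∀ t, 0 ≤ μ t) {prio : N → StrictRanking I}
    (hda : ∀ t : Profile T, IsState μ t → daMatching prio t = greedy R t)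
    {q : Profile T → I → N → ℝ} (hq : IsAllocation q) :
    FOSDDominated R ((1 / 2 : ℝ) • interim μ q) (interim μ (daAllocation prio)) := by
  classical
  intro k
  let A : Finset (TStar μ) := {x | x = k ∨ R.above x k}
  have hA : ∀ x ∈ A, ∀ y, R.above y x → y ∈ A := by
    simp only [A, Finset.mem_filter, Finset.mem_univ, true_and]
    rintro x (rfl | hx) y hy
    exacts [Or.inr hy, Or.inr (R.trans hy hx)]
  have key : 1 / 2 * ∑ x ∈ A, interim μ q x * marginal μ x.1 x.2.1.1 ≤
      ∑ x ∈ A, interim μ (daAllocation prio) x * marginal μ x.1 x.2.1.1 := by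
    rw [sum_interim_mul_marginal, sum_interim_mul_marginal, Finset.mul_sum]
    refine Finset.sum_le_sum fun t _ => ?_
    -- Null profiles need not be states, but they contribute nothing.
    rcases (hμ t).eq_or_lt with h | h
    · simp [← h]
    have ht := isState_of_pos hμ h
    have hle := sum_segment_le ht (hq t).1 (hq t).2.1 (hq t).2.2 hA
    simp only [daAllocation, hda t ht]
    rw [mul_left_comm]
    refine mul_le_mul_of_nonneg_left ?_ h.le
    linarith
  rw [Finset.mul_sum] at key
  convert key using 2 with x
  · rw [Pi.smul_apply, smul_eq_mul, mul_assoc]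

omit [DecidableEq I] in
theorem isAllocation_daAllocation (prio : N → StrictRanking I) :
    IsAllocation (daAllocation (T := T) prio) := by
  classical
  intro t
  have hM : IsMatching (daMatching prio t) :=
    (isStudentOptimalStable_deferredAcceptance (fun i => (t i).1) prio).1.1
  refine ⟨fun i n => ?_, fun i => ?_, fun n => ?_⟩
  · unfold daAllocation
    split_ifs <;> norm_num
  · simp only [daAllocation, Finset.sum_boole]
    exact_mod_cast Finset.card_le_one.2 fun m hm n hn =>
      hM.1 i m n (by simpa using hm) (by simpa using hn)
  · simp only [daAllocation, Finset.sum_boole]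
    exact_mod_cast Finset.card_le_one.2 fun i hi j hj =>
      hM.2 i j n (by simpa using hi) (by simpa using hj)

theorem zero_mem_realizable : (0 : TStar μ → ℝ) ∈ realizable μ :=
  ⟨0, fun t => ⟨by simp, by simp, by simp⟩, by ext x; simp [interim]⟩

/-- Mixing `Q` equally with the null allocation keeps at least half the payoff, by concavity;
monotonicity does the rest. -/
theorem IsPrincipalPayoff.le_two_mul {V : (TStar μ → ℝ) → ℝ} (hV : IsPrincipalPayoff R V)
    {Q Q' : TStar μ → ℝ} (hQ : Q ∈ realizable μ) (hQ' : Q' ∈ realizable μ)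
    (h : FOSDDominated R ((1 / 2 : ℝ) • Q) Q') : V Q ≤ 2 * V Q' := by
  have hhalf : (0 : ℝ) ≤ 1 / 2 := by norm_num
  have hmem : (1 / 2 : ℝ) • Q ∈ realizable μ := by
    have := hV.concave.1 hQ zero_mem_realizable hhalf hhalf (add_halves 1)
    simpa using this
  have hconc := hV.concave.2 hQ zero_mem_realizable hhalf hhalf (add_halves 1)
  rw [hV.null, smul_zero, smul_zero, add_zero, add_zero, smul_eq_mul] at hconc
  linarith [hV.monotone _ hmem _ hQ' h]

end Allocation

end

theorem mainTheorem4 {I N : Type*} [Fintype I] [DecidableEq I] [Fintype N]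
    (T : I → Finset (StrictRanking N)) (μ : Profile T → ℝ) (hμ : μ ∈ stdSimplex ℝ (Profile T))
    (R : StrictRanking (TStar μ)) (hW : IsWelfarist R) (hC : IsItemRankingConsistent R) :
    ∃ prio : N → StrictRanking I,
      (∀ t : Profile T, IsState μ t →
        daMatching prio t = greedy R t ∧
          IsStudentOptimalStable (fun i => (t i).1) prio (daMatching prio t)) ∧
      interim μ (daAllocation prio) ∈ realizable μ ∧
      ∀ V : (TStar μ → ℝ) → ℝ, IsPrincipalPayoff R V →
        BddAbove (V '' realizable μ) ∧
          (1 / 2) * fullInformationPayoff μ V ≤ V (interim μ (daAllocation prio)) := by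
  obtain ⟨prio, hprio⟩ := exists_prioritiesRespect hC
  have hda : ∀ t : Profile T, IsState μ t → daMatching prio t = greedy R t :=
    fun t ht => daMatching_eq_greedy hW hprio ht
  have hreal : interim μ (daAllocation prio) ∈ realizable μ :=
    ⟨_, isAllocation_daAllocation prio, rfl⟩
  refine ⟨prio, fun t ht => ⟨hda t ht, isStudentOptimalStable_deferredAcceptance _ _⟩, hreal,
    fun V hV => ?_⟩
  -- This bound also yields finiteness of the full-information payoff.
  have hbound : ∀ v ∈ V '' realizable μ, v ≤ 2 * V (interim μ (daAllocation prio)) := by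
    rintro _ ⟨Q, ⟨q, hq, rfl⟩, rfl⟩
    exact hV.le_two_mul ⟨q, hq, rfl⟩ hreal (fosdDominated_half hμ.1 hda hq)
  refine ⟨⟨_, hbound⟩, ?_⟩
  have hsup : fullInformationPayoff μ V ≤ 2 * V (interim μ (daAllocation prio)) :=
    csSup_le ⟨_, Set.mem_image_of_mem V hreal⟩ hbound
  linarith
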